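/- Let $\alpha\in(0,0.3624)$, $\beta\in(1,2]$, $\kappa>0$, $x_L<x_R$, $T>0$, let $N,M$ be positive integers, and put $h=(x_R-x_L)/N$, $\tau=T/M$. Let $I_x$ and $I_t$ be the identity matrices of orders $N-1$ and $M-1$. For $\ell\ge 0$ set $$a_\ell=(\ell+1)^{1-\alpha}-\ell^{1-\alpha},\qquad b_\ell=\frac{(\ell+1)^{2-\alpha}-\ell^{2-\alpha}}{2-\alpha}-\frac{(\ell+1)^{1-\alpha}+\ell^{1-\alpha}}{2},$$ $c_0=a_0+b_0$, $c_s=a_s+b_s-b_{s-1}$ $(s\ge1)$, $\tilde c_0=a_0+b_0+b_1$, $\tilde c_k=a_k+b_k+b_{k+1}-b_{k-1}$ $(k\ge1)$. Let $A_t$ be the lower triangular matrix of order $M-1$ equal to $\dfrac{h^{\beta}\tau^{-\alpha}}{\Gamma(2-\alpha)}$ times the matrix whose first column is $(\tilde c_0,\ \tilde c_1-c_0,\ \tilde c_2-c_1,\dots,\tilde c_{M-2}-c_{M-3})^T$ and whose remaining rows and columns $2,\dots,M-1$ form the lower triangular Toeplitz matrix with first column $(c_0,\ c_1-c_0,\dots,c_{M-3}-c_{M-4})^T$.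 Let $$g_k=\frac{(-1)^k\,\Gamma(1+\beta)}{\Gamma(\beta/2-k+1)\,\Gamma(\beta/2+k+1)}\quad(k\in\mathbb Z,\ 1/\Gamma=0 \text{ at the poles of }\Gamma),$$ let $G_\beta=(g_{i-j})_{1\le i,j\le N-1}$, let $H_\beta=(h_{ij})_{1\le i,j\le N-1}$ be the Hankel matrix with $h_{ij}=g_{i+j}$ if $i+j\le N-2$, $h_{ij}=0$ if $N-1\le i+j\le N+1$, and $h_{ij}=g_{2N-(i+j)}$ if $i+j\ge N+2$, and put $G_\tau=G_\beta-H_\beta$. Then $G_\tau$ is symmetric positive definite. With $$\tilde{\mathcal M}=(\kappa G_\beta)\otimes I_t+I_x\otimes A_t,\quad P_l=(\kappa G_\tau)^{-1/2}\otimes A_t+(\kappa G_\tau)^{1/2}\otimes I_t,\quad P_r=(\kappa G_\tau)^{1/2}\otimes I_t,$$ the matrices $P_l$, $P_r$ and $P_l^{-1}\tilde{\mathcal M}P_r^{-1}$ are nonsingular, and $$\kappa_2\bigl(P_l^{-1}\tilde{\mathcal M}P_r^{-1}\bigr)<2\sqrt3,$$ where $\kappa_2(A)=\|A^{-1}\|_2\,\|A\|_2$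 and $\|\cdot\|_2$ is the spectral norm. In particular the bound is uniform in $h$ and $\tau$. -/

import Mathlib

open scoped Kronecker

noncomputable section

namespace BlochTorrey

/-- The coefficients `a_ℓ = (ℓ+1)^{1-α} - ℓ^{1-α}`. -/
def a (α : ℝ) (l : ℕ) : ℝ :=
  ((l : ℝ) + 1) ^ (1 - α) - (l : ℝ) ^ (1 - α)

/-- The coefficients
`b_ℓ = ((ℓ+1)^{2-α} - ℓ^{2-α}) / (2-α) - ((ℓ+1)^{1-α} + ℓ^{1-α}) / 2`. -/
def b (α : ℝ) (l : ℕ) : ℝ :=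
  1 / (2 - α) * (((l : ℝ) + 1) ^ (2 - α) - (l : ℝ) ^ (2 - α))
    - 1 / 2 * (((l : ℝ) + 1) ^ (1 - α) + (l : ℝ) ^ (1 - α))

/-- `c_0 = a_0 + b_0` and `c_s = a_s + b_s - b_{s-1}` for `s ≥ 1`. -/
def c (α : ℝ) : ℕ → ℝ
  | 0 => a α 0 + b α 0
  | s + 1 => a α (s + 1) + b α (s + 1) - b α s

/-- `c̃_0 = a_0 + b_0 + b_1` and `c̃_k = a_k + b_k + b_{k+1} - b_{k-1}` for `k ≥ 1`. -/
def cTilde (α : ℝ) : ℕ → ℝ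
  | 0 => a α 0 + b α 0 + b α 1
  | k + 1 => a α (k + 1) + b α (k + 1) + b α (k + 2) - b α k

/-- The fractional centered difference coefficients
`g_k = (-1)^k Γ(1+β) / (Γ(β/2-k+1) Γ(β/2+k+1))`.
For `β = 2` and `|k| ≥ 2` one factor of the denominator is at a pole of `Γ`; there `1/Γ` is `0`,
which is also the value given by the conventions `Real.Gamma (-n) = 0` and `x / 0 = 0`. -/
def g (β : ℝ) (k : ℤ) : ℝ :=
  (-1 : ℝ) ^ k * Real.Gamma (1 + β)
    / (Real.Gamma (β / 2 - (k : ℝ) + 1) * Real.Gamma (β / 2 + (k : ℝ) + 1))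

/-- The Toeplitz matrix `G_β = (g_{i-j})` of order `N - 1`. -/
def Gbeta (β : ℝ) (N : ℕ) : Matrix (Fin (N - 1)) (Fin (N - 1)) ℝ :=
  Matrix.of fun i j => g β ((i : ℤ) - (j : ℤ))

/-- The entry of the Hankel matrix `H_β` on the antidiagonal `i + j = s`, where the rows and
columns are numbered `1, …, N - 1`, so `s = 2, …, 2N - 2`. The antidiagonals are, in this order,
`g_2, …, g_{N-2}, 0, 0, 0, g_{N-2}, …, g_2`. -/
def hankelEntry (β : ℝ) (N s : ℕ) : ℝ :=
  if s + 2 ≤ N then g β (s : ℤ)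
  else if s ≤ N + 1 then 0
  else g β (2 * (N : ℤ) - (s : ℤ))

/-- The Hankel matrix `H_β` of order `N - 1`. The shifts turn the `0`-based indices of `Fin` into
the indices `1, …, N - 1`. -/
def Hbeta (β : ℝ) (N : ℕ) : Matrix (Fin (N - 1)) (Fin (N - 1)) ℝ :=
  Matrix.of fun i j => hankelEntry β N (((i : ℕ) + 1) + ((j : ℕ) + 1))

/-- The `τ`-matrix `G_τ = G_β - H_β`. -/
def Gtau (β : ℝ) (N : ℕ) : Matrix (Fin (N - 1)) (Fin (N - 1)) ℝ :=
  Gbeta β N - Hbeta β N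

/-- The lower triangular matrix `A_t` of order `M - 1` (indices `0, …, M - 2`), with space step `h`
and time step `τ`: the first column is `c̃_0, c̃_1 - c_0, c̃_2 - c_1, …`, and the remaining
columns form the lower triangular Toeplitz matrix with first column `c_0, c_1 - c_0, c_2 - c_1, …`;
everything is multiplied by `h^β τ^{-α} / Γ(2-α)`. -/
def At (α β h τ : ℝ) (M : ℕ) : Matrix (Fin (M - 1)) (Fin (M - 1)) ℝ :=
  Matrix.of fun i j =>
    h ^ β * τ ^ (-α) / Real.Gamma (2 - α) *
      (if (i : ℕ) < (j : ℕ) then 0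
       else if (j : ℕ) = 0 then
         (if (i : ℕ) = 0 then cTilde α 0 else cTilde α (i : ℕ) - c α ((i : ℕ) - 1))
       else if (i : ℕ) = (j : ℕ) then c α 0
       else c α ((i : ℕ) - (j : ℕ)) - c α ((i : ℕ) - (j : ℕ) - 1))

/-- The all-at-once matrix `(κ G_β) ⊗ I_t + I_x ⊗ A_t`. -/
def MTilde (α β κ h τ : ℝ) (N M : ℕ) :
    Matrix (Fin (N - 1) × Fin (M - 1)) (Fin (N - 1) × Fin (M - 1)) ℝ :=
  (κ • Gbeta β N) ⊗ₖ (1 : Matrix (Fin (M - 1)) (Fin (M - 1)) ℝ)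
    + (1 : Matrix (Fin (N - 1)) (Fin (N - 1)) ℝ) ⊗ₖ At α β h τ M

open scoped MatrixOrder in
/-- `(κ G_τ)^{1/2}`, the positive semidefinite square root. -/
def sqrtGtau (β κ : ℝ) (N : ℕ) : Matrix (Fin (N - 1)) (Fin (N - 1)) ℝ :=
  CFC.sqrt (κ • Gtau β N)

/-- The left preconditioner `(κ G_τ)^{-1/2} ⊗ A_t + (κ G_τ)^{1/2} ⊗ I_t`. -/
def Pl (α β κ h τ : ℝ) (N M : ℕ) :
    Matrix (Fin (N - 1) × Fin (M - 1)) (Fin (N - 1) × Fin (M - 1)) ℝ :=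
  (sqrtGtau β κ N)⁻¹ ⊗ₖ At α β h τ M
    + sqrtGtau β κ N ⊗ₖ (1 : Matrix (Fin (M - 1)) (Fin (M - 1)) ℝ)

/-- The right preconditioner `(κ G_τ)^{1/2} ⊗ I_t`. -/
def Pr (β κ : ℝ) (N M : ℕ) :
    Matrix (Fin (N - 1) × Fin (M - 1)) (Fin (N - 1) × Fin (M - 1)) ℝ :=
  sqrtGtau β κ N ⊗ₖ (1 : Matrix (Fin (M - 1)) (Fin (M - 1)) ℝ)

open scoped Matrix.Norms.L2Operator in
/-- The spectral condition number `κ₂(A) = ‖A⁻¹‖₂ ‖A‖₂` of a nonsingular matrix. -/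
def cond2 {n : Type*} [Fintype n] [DecidableEq n] (A : Matrix n n ℝ) : ℝ :=
  ‖A⁻¹‖ * ‖A‖

end BlochTorrey

end

noncomputable section

namespace BlochTorrey

/-! Put `S = (κ G_τ)^{1/2} ⊗ I`, `A = I ⊗ A_t`, `E = κ H_β ⊗ I`. Then `S` and `A` commute, the
all-at-once matrix is `S² + E + A`, and `P_l = S⁻¹A + S = S(1 + B)` with `B = S⁻¹AS⁻¹`. Hence the
preconditioned matrix is `1 + (1 + B)⁻¹K` with `K = S⁻¹ES⁻¹`. If `B` has a nonnegative quadratic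
form, then `‖(1 + B)⁻¹‖ ≤ 1`; if moreover `‖K‖ ≤ 1/2`, the perturbation of the identity has norm at
most `1/2`, and the condition number is at most `(3/2) / (1/2) = 3 < 2√3`. This is
`cond2_preconditioned_le`.

Two facts remain. `At_quadratic_nonneg`: the form of `A_t` is nonnegative, because `A_t` is
diagonally dominant when row and column sums are averaged. The sums telescope once `c` is
decreasing, and the corrections `b` in the first column are small; both rest on reading `b_ℓ` as the
error of a trapezoidal rule.

`abs_Hbeta_quadratic_le`: `|H_β| ≤ G_τ / 2` as forms, which says that `G_β - 3H_β` and `G_β + H_β`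
are positive semidefinite. Both are diagonally dominant, since in each row the indices of the
Toeplitz and Hankel entries fill two almost disjoint ranges and `∑_{k≥1} |g_k| ≤ g_0 / 2` over each.
The same count makes `G_τ` positive definite. -/

/-! ### Estimates for the coefficients `a`, `b`, `c`. -/

/-- A function vanishing to first order at `0` with nonnegative second derivative on `[0, 1]` is
nonnegative at `1`. -/
theorem nonneg_at_one_of_second_deriv_nonneg {φ φ' φ'' : ℝ → ℝ}
    (h1 : ∀ x ∈ Set.Icc (0 : ℝ) 1, HasDerivAt φ (φ' x) x)
    (h2 : ∀ x ∈ Set.Icc (0 : ℝ) 1, HasDerivAt φ' (φ'' x) x)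
    (h0 : φ 0 = 0) (h0' : φ' 0 = 0) (hpos : ∀ x ∈ Set.Icc (0 : ℝ) 1, 0 ≤ φ'' x) : 0 ≤ φ 1 := by
  have key : ∀ {u u' : ℝ → ℝ}, (∀ x ∈ Set.Icc (0 : ℝ) 1, HasDerivAt u (u' x) x) → u 0 = 0 →
      (∀ x ∈ Set.Icc (0 : ℝ) 1, 0 ≤ u' x) → ∀ x ∈ Set.Icc (0 : ℝ) 1, 0 ≤ u x := by
    intro u u' hu hu0 hu' x hx
    have hm : MonotoneOn u (Set.Icc (0 : ℝ) 1) := by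
      refine monotoneOn_of_deriv_nonneg (convex_Icc 0 1)
        (fun y hy => (hu y hy).continuousAt.continuousWithinAt)
        (fun y hy => (hu y (interior_subset hy)).differentiableAt.differentiableWithinAt) ?_
      intro y hy
      rw [(hu y (interior_subset hy)).deriv]
      exact hu' y (interior_subset hy)
    have := hm (Set.left_mem_Icc.2 zero_le_one) hx hx.1
    rwa [hu0] at this
  exact key h1 h0 (key h2 h0' hpos) 1 (Set.right_mem_Icc.2 zero_le_one)

/-- Minus the second derivative of `x ↦ x ^ (1 - α)`. -/
def curvature (α x : ℝ) : ℝ := α * (1 - α) * x ^ (-α - 1)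

theorem curvature_anti {α x y : ℝ} (h0 : 0 ≤ α) (h1 : α ≤ 1) (hx : 0 < x) (hxy : x ≤ y) :
    curvature α y ≤ curvature α x :=
  mul_le_mul_of_nonneg_left (Real.rpow_le_rpow_of_nonpos hx hxy (by linarith))
    (mul_nonneg h0 (by linarith))

theorem curvature_nonneg {α x : ℝ} (h0 : 0 ≤ α) (h1 : α ≤ 1) (hx : 0 ≤ x) :
    0 ≤ curvature α x :=
  mul_nonneg (mul_nonneg h0 (by linarith)) (Real.rpow_nonneg hx _)

theorem hasDerivAt_add_rpow {l x r : ℝ} (hl : 0 < l + x) :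
    HasDerivAt (fun x => (l + x) ^ r) (r * (l + x) ^ (r - 1)) x := by
  have := ((hasDerivAt_id x).const_add l).rpow_const (p := r) (Or.inl hl.ne')
  simpa [mul_comm, mul_left_comm] using this

theorem hasDerivAt_sub_rpow {l x r : ℝ} (hl : 0 < l - x) :
    HasDerivAt (fun x => (l - x) ^ r) (-(r * (l - x) ^ (r - 1))) x := by
  have := ((hasDerivAt_id x).const_sub l).rpow_const (p := r) (Or.inl hl.ne')
  simpa [mul_comm, mul_left_comm] using this

/-- The error of the trapezoidal rule for `x ↦ x ^ (1 - α)` on `[l, l + x]`, minus `K x³ / 12`. -/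
def trapezoidDefect (α l K x : ℝ) : ℝ :=
  ((l + x) ^ (2 - α) - l ^ (2 - α)) / (2 - α) - x * ((l + x) ^ (1 - α) + l ^ (1 - α)) / 2
    - K * x ^ 3 / 12

def trapezoidDefect' (α l K x : ℝ) : ℝ :=
  (l + x) ^ (1 - α) - ((l + x) ^ (1 - α) + l ^ (1 - α)) / 2
    - x * ((1 - α) * (l + x) ^ (-α)) / 2 - K * x ^ 2 / 4

theorem hasDerivAt_trapezoidDefect {α l K x : ℝ} (hα : α < 1) (hl : 0 < l + x) :
    HasDerivAt (trapezoidDefect α l K) (trapezoidDefect' α l K x) x := by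
  have e1 : (2 - α) - 1 = 1 - α := by ring
  have e2 : (1 - α) - 1 = -α := by ring
  have d1 := hasDerivAt_add_rpow (r := 2 - α) hl
  have d2 := hasDerivAt_add_rpow (r := 1 - α) hl
  rw [e1] at d1
  rw [e2] at d2
  have := (((d1.sub_const (l ^ (2 - α))).div_const (2 - α)).sub
    (((hasDerivAt_id x).mul (d2.add_const (l ^ (1 - α)))).div_const 2)).sub
    (((hasDerivAt_pow 3 x).const_mul K).div_const 12)
  refine this.congr_deriv ?_
  have h2 : (2 - α) ≠ 0 := by linarith
  simp only [trapezoidDefect', id]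
  field_simp
  push_cast
  ring

theorem hasDerivAt_trapezoidDefect' {α l K x : ℝ} (hl : 0 < l + x) :
    HasDerivAt (trapezoidDefect' α l K) (x / 2 * (curvature α (l + x) - K)) x := by
  have e2 : (1 - α) - 1 = -α := by ring
  have d2 := hasDerivAt_add_rpow (r := 1 - α) hl
  have d3 := hasDerivAt_add_rpow (r := -α) hl
  rw [e2] at d2
  have := ((d2.sub ((d2.add_const (l ^ (1 - α))).div_const 2)).sub
    (((hasDerivAt_id x).mul (d3.const_mul (1 - α))).div_const 2)).sub
    (((hasDerivAt_pow 2 x).const_mul K).div_const 4)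
  refine this.congr_deriv ?_
  simp only [curvature, id]
  push_cast
  ring

theorem trapezoidDefect_one (α K : ℝ) (l : ℕ) :
    trapezoidDefect α l K 1 = b α l - K / 12 := by
  simp only [trapezoidDefect, b]; ring

/-- `b_l` is the trapezoidal error on `[l, l + 1]`, hence a twelfth of the curvature at an
intermediate point. The comparison constant `K` is the curvature at an endpoint; `l ≥ 1` avoids the
singularity at `0`. -/
theorem b_ge_curvature {α : ℝ} (h0 : 0 ≤ α) (h1 : α < 1) {l : ℕ} (hl : 1 ≤ l) :
    curvature α (l + 1) / 12 ≤ b α l := by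
  have hl' : (1 : ℝ) ≤ l := by exact_mod_cast hl
  have := nonneg_at_one_of_second_deriv_nonneg
    (fun x hx => hasDerivAt_trapezoidDefect (α := α) (l := l) (K := curvature α (l + 1)) h1
      (by linarith [hx.1]))
    (fun x hx => hasDerivAt_trapezoidDefect' (by linarith [hx.1]))
    (by simp [trapezoidDefect]) (by simp [trapezoidDefect'])
    (fun x hx => mul_nonneg (by linarith [hx.1]) (sub_nonneg.2
      (curvature_anti h0 h1.le (by linarith [hx.1]) (by linarith [hx.2]))))
  rw [trapezoidDefect_one] at this
  linarith

theorem b_le_curvature {α : ℝ} (h0 : 0 ≤ α) (h1 : α < 1) {l : ℕ} (hl : 1 ≤ l) :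
    b α l ≤ curvature α l / 12 := by
  have hl' : (1 : ℝ) ≤ l := by exact_mod_cast hl
  have := nonneg_at_one_of_second_deriv_nonneg
    (fun x hx => (hasDerivAt_trapezoidDefect (α := α) (l := l) (K := curvature α l) h1
      (by linarith [hx.1])).neg)
    (fun x hx => (hasDerivAt_trapezoidDefect' (by linarith [hx.1])).neg)
    (by simp [trapezoidDefect]) (by simp [trapezoidDefect'])
    (fun x hx => by
      rw [neg_nonneg]
      exact mul_nonpos_of_nonneg_of_nonpos (by linarith [hx.1]) (sub_nonpos.2
      (curvature_anti h0 h1.le (by linarith [hx.1]) (by linarith [hx.1]))))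
  rw [Pi.neg_apply, trapezoidDefect_one] at this
  linarith

/-- The difference is minus the second central difference of `x ^ (1 - α)` at `s + 1`, so it is at
least the smallest curvature on `[s, s + 2]`. -/
theorem a_sub_a_succ_ge {α : ℝ} (h0 : 0 ≤ α) (h1 : α < 1) {s : ℕ} (hs : 1 ≤ s) :
    curvature α (s + 2) ≤ a α s - a α (s + 1) := by
  have hs' : (1 : ℝ) ≤ s := by exact_mod_cast hs
  have e2 : (1 - α) - 1 = -α := by ring
  have key := nonneg_at_one_of_second_deriv_nonneg
    (φ := fun x => 2 * ((s : ℝ) + 1) ^ (1 - α) - ((s : ℝ) + 1 - x) ^ (1 - α)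
      - ((s : ℝ) + 1 + x) ^ (1 - α) - curvature α (s + 2) * x ^ 2)
    (φ' := fun x => (1 - α) * ((s : ℝ) + 1 - x) ^ (-α)
      - (1 - α) * ((s : ℝ) + 1 + x) ^ (-α) - 2 * curvature α (s + 2) * x)
    (φ'' := fun x => curvature α ((s : ℝ) + 1 - x) + curvature α ((s : ℝ) + 1 + x)
      - 2 * curvature α (s + 2))
    (fun x hx => by
      have d1 := hasDerivAt_sub_rpow (l := (s : ℝ) + 1) (x := x) (r := 1 - α) (by linarith [hx.2])
      have d2 := hasDerivAt_add_rpow (l := (s : ℝ) + 1) (x := x) (r := 1 - α) (by linarith [hx.1])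
      rw [e2] at d1 d2
      refine (((d1.const_sub (2 * ((s : ℝ) + 1) ^ (1 - α))).sub d2).sub
        ((hasDerivAt_pow 2 x).const_mul (curvature α (s + 2)))).congr_deriv ?_
      push_cast; ring)
    (fun x hx => by
      have d1 := hasDerivAt_sub_rpow (l := (s : ℝ) + 1) (x := x) (r := -α) (by linarith [hx.2])
      have d2 := hasDerivAt_add_rpow (l := (s : ℝ) + 1) (x := x) (r := -α) (by linarith [hx.1])
      refine (((d1.const_mul (1 - α)).sub (d2.const_mul (1 - α))).sub
        ((hasDerivAt_id x).const_mul (2 * curvature α (s + 2)))).congr_deriv ?_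
      simp only [curvature]; ring)
    (by simp; ring) (by simp)
    (fun x hx => by
      have i1 := curvature_anti h0 h1.le (x := (s : ℝ) + 1 - x) (y := s + 2)
        (by linarith [hx.2]) (by linarith [hx.1])
      have i2 := curvature_anti h0 h1.le (x := (s : ℝ) + 1 + x) (y := s + 2)
        (by linarith [hx.1]) (by linarith [hx.2])
      linarith)
  have e3 : (s : ℝ) + 1 + 1 = ((s + 1 : ℕ) : ℝ) + 1 := by push_cast; ring
  simp only [add_sub_cancel_right, e3] at key
  simp only [a]
  push_cast at key ⊢
  linarith

theorem curvature_le_twelve_mul {α : ℝ} (h0 : 0 ≤ α) (h1 : α ≤ 1 / 2) {l : ℕ} (hl : 1 ≤ l) :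
    curvature α l ≤ 12 * curvature α (l + 3) := by
  have hl' : (1 : ℝ) ≤ l := by exact_mod_cast hl
  have hpos : (0 : ℝ) < l := by linarith
  have key : (l : ℝ) ^ (-α - 1) ≤ 12 * ((l : ℝ) + 3) ^ (-α - 1) := by
    have e : -α - 1 = -(α + 1) := by ring
    rw [e, Real.rpow_neg hpos.le, Real.rpow_neg (by linarith), ← div_eq_mul_inv,
      inv_eq_one_div, div_le_div_iff₀ (Real.rpow_pos_of_pos hpos _)
      (Real.rpow_pos_of_pos (by linarith) _), one_mul]
    -- Since `l + 3 ≤ 4l`, the ratio is at most `4 ^ (α + 1) ≤ 8` for `α ≤ 1/2`.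
    calc ((l : ℝ) + 3) ^ (α + 1) ≤ (4 * l) ^ (α + 1) :=
          Real.rpow_le_rpow (by linarith) (by linarith) (by linarith)
      _ = 4 ^ (α + 1) * (l : ℝ) ^ (α + 1) := Real.mul_rpow (by norm_num) hpos.le
      _ ≤ 12 * (l : ℝ) ^ (α + 1) := by
          refine mul_le_mul_of_nonneg_right ?_ (Real.rpow_nonneg hpos.le _)
          rw [Real.rpow_add (by norm_num), Real.rpow_one]
          have : (4 : ℝ) ^ α ≤ 4 ^ (1 / 2 : ℝ) := Real.rpow_le_rpow_of_exponent_le (by norm_num) h1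
          rw [← Real.sqrt_eq_rpow, show (4 : ℝ) = 2 ^ 2 by norm_num,
            Real.sqrt_sq (by norm_num)] at this
          norm_num at this ⊢
          linarith
  have := mul_le_mul_of_nonneg_left key (mul_nonneg h0 (by linarith : 0 ≤ 1 - α))
  simp only [curvature]
  linarith

/-- The factor `1/12` of the trapezoidal error outweighs the decay of the curvature from `l` to `l +
3`. This lets differences of `a` absorb every `b` of positive index. -/
theorem b_le_a_sub_a {α : ℝ} (h0 : 0 ≤ α) (h1 : α ≤ 1 / 2) {l : ℕ} (hl : 1 ≤ l) :
    b α l ≤ a α (l + 1) - a α (l + 2) := by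
  have i1 := b_le_curvature h0 (by linarith) hl
  have i2 := curvature_le_twelve_mul h0 h1 hl
  have i3 := a_sub_a_succ_ge h0 (by linarith) (s := l + 1) (by omega)
  have e : (((l + 1 : ℕ) : ℝ) + 2) = (l : ℝ) + 3 := by push_cast; ring
  rw [e] at i3
  linarith

theorem b_succ_le {α : ℝ} (h0 : 0 ≤ α) (h1 : α < 1) {l : ℕ} (hl : 1 ≤ l) :
    b α (l + 1) ≤ b α l := by
  have i1 := b_le_curvature h0 h1 (l := l + 1) (by omega)
  have i2 := b_ge_curvature h0 h1 hl
  push_cast at i1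
  linarith

theorem b_zero {α : ℝ} (h1 : α < 1) : b α 0 = 1 / (2 - α) - 1 / 2 := by
  simp [b, Real.zero_rpow (by linarith : (1 - α) ≠ 0), Real.zero_rpow (by linarith : (2 - α) ≠ 0)]

theorem a_zero {α : ℝ} (h1 : α < 1) : a α 0 = 1 := by
  simp [a, Real.zero_rpow (by linarith : (1 - α) ≠ 0)]

theorem a_nonneg {α : ℝ} (h1 : α < 1) (l : ℕ) : 0 ≤ a α l :=
  sub_nonneg.2 (Real.rpow_le_rpow (by positivity) (by linarith) (by linarith))

theorem a_one_le {α : ℝ} (h0 : 0 ≤ α) : a α 1 ≤ 1 := by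
  have : (2 : ℝ) ^ (1 - α) ≤ 2 ^ (1 : ℝ) :=
    Real.rpow_le_rpow_of_exponent_le (by norm_num) (by linarith)
  simp only [a]
  norm_num at this ⊢
  linarith

theorem b_nonneg {α : ℝ} (h0 : 0 ≤ α) (h1 : α < 1) (l : ℕ) : 0 ≤ b α l := by
  rcases Nat.eq_zero_or_pos l with rfl | hl
  · rw [b_zero h1, sub_nonneg, div_le_div_iff₀ (by norm_num) (by linarith)]
    linarith
  · have i1 := b_ge_curvature h0 h1 hl
    have i2 := curvature_nonneg h0 h1.le (x := (l : ℝ) + 1) (by positivity)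
    linarith

theorem b_one_le_b_zero {α : ℝ} (h0 : 0 ≤ α) (h1 : α < 1) : b α 1 ≤ b α 0 := by
  have i1 := b_le_curvature h0 h1 (l := 1) le_rfl
  have : α / 4 ≤ b α 0 := by
    have : (1 / 2 + α / 4) * (2 - α) ≤ 1 := by nlinarith
    rw [b_zero h1]
    have := (le_div_iff₀ (by linarith : 0 < 2 - α)).2 this
    linarith
  simp only [curvature, Nat.cast_one, Real.one_rpow] at i1
  nlinarith

theorem a_succ_le {α : ℝ} (h0 : 0 ≤ α) (h1 : α < 1) (l : ℕ) : a α (l + 1) ≤ a α l := by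
  rcases Nat.eq_zero_or_pos l with rfl | hl
  · rw [a_zero h1]; exact a_one_le h0
  · have i1 := a_sub_a_succ_ge h0 h1 hl
    have i2 := curvature_nonneg h0 h1.le (x := (l : ℝ) + 2) (by positivity)
    linarith

theorem a_antitone {α : ℝ} (h0 : 0 ≤ α) (h1 : α < 1) : Antitone (a α) :=
  antitone_nat_of_succ_le (a_succ_le h0 h1)

theorem exp_neg_bound {t : ℝ} (h0 : 0 ≤ t) (h1 : t ≤ 1) :
    |Real.exp (-t) - (1 - t + t ^ 2 / 2 - t ^ 3 / 6 + t ^ 4 / 24)| ≤ t ^ 5 / 100 := by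
  have := Real.exp_bound (x := -t) (by rw [abs_neg, abs_of_nonneg h0]; exact h1) (n := 5)
    (by norm_num)
  rw [abs_neg, abs_of_nonneg h0] at this
  simp only [Finset.sum_range_succ, Finset.sum_range_zero, Nat.factorial] at this
  refine le_trans (le_of_eq ?_) (this.trans (le_of_eq ?_))
  · congr 1; push_cast; ring
  · push_cast; ring

/-- The right side is `2(2 - α)(c_1 - c_2)` with `log 2` rounded up and `log 3` rounded down, the
directions that decrease it. Only here is the value `0.3624` used beyond `α ≤ 1/2`. -/
theorem two_three_rpow_ineq {α : ℝ} (h0 : 0 ≤ α) (h1 : α ≤ 0.3624) :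
    0 ≤ (36 - 6 * α) * Real.exp (-(α * 0.693148)) - (24 - 3 * α) * Real.exp (-(α * 1.0986))
      - 12 + 3 * α := by
  norm_num at h1
  have i1 := (abs_le.1 (exp_neg_bound (t := α * 0.693148) (by positivity) (by linarith))).1
  have i2 := (abs_le.1 (exp_neg_bound (t := α * 1.0986) (by positivity) (by linarith))).2
  have j1 := mul_le_mul_of_nonneg_left i1 (by linarith : 0 ≤ 36 - 6 * α)
  have j2 := mul_le_mul_of_nonneg_left i2 (by linarith : 0 ≤ 24 - 3 * α)
  -- The expression vanishes at `α = 0`. This cubic is its Taylor polynomial divided by `α`,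
  -- coefficients rounded down; the last is lowered further to absorb the fifth-order terms.
  have hcubic : 0 ≤ 1.413 - 4.972 * α + 3.674 * α ^ 2 - 1.556 * α ^ 3 := by
    have hu : 0 ≤ 453 / 1250 - α := by linarith
    nlinarith [mul_nonneg hu h0, mul_nonneg (mul_nonneg hu h0) h0]
  have k1 := mul_nonneg h0 hcubic
  have k2 := mul_nonneg (pow_nonneg h0 4) (by linarith : 0 ≤ 453 / 1250 - α)
  have k3 := pow_nonneg h0 6
  have k4 := pow_nonneg h0 4
  have k5 := mul_nonneg (pow_nonneg h0 2) (by linarith : 0 ≤ 453 / 1250 - α)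
  have k6 := pow_nonneg h0 2
  have k7 := pow_nonneg h0 3
  nlinarith only [j1, j2, k1, k2, k3, k4, k5, k6, k7, h0, h1]

theorem c_two_le_c_one {α : ℝ} (h0 : 0 ≤ α) (h1 : α ≤ 0.3624) : c α 2 ≤ c α 1 := by
  have key := two_three_rpow_ineq h0 h1
  norm_num at h1
  have hp : (2 : ℝ) ^ (1 - α) = 2 * Real.exp (-(α * Real.log 2)) := by
    rw [Real.rpow_sub (by norm_num), Real.rpow_one, Real.rpow_def_of_pos (by norm_num),
      Real.exp_neg, div_eq_mul_inv, mul_comm α]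
  have hq : (3 : ℝ) ^ (1 - α) = 3 * Real.exp (-(α * Real.log 3)) := by
    rw [Real.rpow_sub (by norm_num), Real.rpow_one, Real.rpow_def_of_pos (by norm_num),
      Real.exp_neg, div_eq_mul_inv, mul_comm α]
  have hp' : (2 : ℝ) ^ (2 - α) = 2 * 2 ^ (1 - α) := by
    rw [show 2 - α = 1 + (1 - α) by ring, Real.rpow_add (by norm_num), Real.rpow_one]
  have hq' : (3 : ℝ) ^ (2 - α) = 3 * 3 ^ (1 - α) := by
    rw [show 2 - α = 1 + (1 - α) by ring, Real.rpow_add (by norm_num), Real.rpow_one]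
  have m2 : Real.exp (-(α * 0.693148)) ≤ Real.exp (-(α * Real.log 2)) :=
    Real.exp_le_exp.2 (neg_le_neg (mul_le_mul_of_nonneg_left
      (by linarith [Real.log_two_lt_d9]) h0))
  have m3 : Real.exp (-(α * Real.log 3)) ≤ Real.exp (-(α * 1.0986)) :=
    Real.exp_le_exp.2 (neg_le_neg (mul_le_mul_of_nonneg_left
      (by linarith [Real.log_three_gt_d9]) h0))
  have j2 := mul_le_mul_of_nonneg_left m2 (by linarith : 0 ≤ 36 - 6 * α)
  have j3 := mul_le_mul_of_nonneg_left m3 (by linarith : 0 ≤ 24 - 3 * α)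
  have h2 : 0 < 2 - α := by linarith
  have e : 2 * (2 - α) * (c α 1 - c α 2) = (36 - 6 * α) * Real.exp (-(α * Real.log 2))
      - (24 - 3 * α) * Real.exp (-(α * Real.log 3)) - 12 + 3 * α := by
    simp only [c, b_zero (by linarith : α < 1)]
    simp only [a, b]
    norm_num
    rw [hp', hq', hp, hq]
    field_simp
    ring
  have : 0 ≤ 2 * (2 - α) * (c α 1 - c α 2) := by rw [e]; linarith
  have := nonneg_of_mul_nonneg_right this (by linarith)
  linarith

theorem c_succ_le {α : ℝ} (h0 : 0 ≤ α) (h1 : α ≤ 0.3624) (s : ℕ) : c α (s + 1) ≤ c α s := by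
  have h2 : α ≤ 1 / 2 := by norm_num at h1 ⊢; linarith
  have h3 : α < 1 := by linarith
  match s with
  | 0 =>
    have := a_succ_le h0 h3 0
    have := b_one_le_b_zero h0 h3
    have := b_nonneg h0 h3 0
    simp only [c]
    linarith
  -- Here `b_0` enters negatively, and the curvature bounds do not cover it.
  | 1 => exact c_two_le_c_one h0 h1
  | s + 2 =>
    have := b_le_a_sub_a h0 h2 (l := s + 1) (by omega)
    have := b_succ_le h0 h3 (l := s + 2) (by omega)
    have := b_nonneg h0 h3 (s + 2)
    simp only [c]
    linarith

theorem c_antitone {α : ℝ} (h0 : 0 ≤ α) (h1 : α ≤ 0.3624) : Antitone (c α) :=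
  antitone_nat_of_succ_le (c_succ_le h0 h1)

theorem a_succ_le_c {α : ℝ} (h0 : 0 ≤ α) (h1 : α ≤ 1 / 2) {s : ℕ} (hs : 2 ≤ s) :
    a α (s + 1) ≤ c α s := by
  obtain ⟨s, rfl⟩ := Nat.exists_eq_add_of_le' hs
  have := b_le_a_sub_a h0 h1 (l := s + 1) (by omega)
  have := b_nonneg h0 (by linarith) (s + 2)
  simp only [c]
  linarith

theorem c_nonneg {α : ℝ} (h0 : 0 ≤ α) (h1 : α ≤ 0.3624) (s : ℕ) : 0 ≤ c α s := by
  have h2 : α ≤ 1 / 2 := by norm_num at h1 ⊢; linarith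
  have h3 : α < 1 := by linarith
  have := c_antitone h0 h1 (show s ≤ s + 2 by omega)
  have := a_succ_le_c h0 h2 (s := s + 2) (by omega)
  have := a_nonneg h3 (s + 2 + 1)
  linarith

theorem one_le_c_zero {α : ℝ} (h0 : 0 ≤ α) (h1 : α < 1) : 1 ≤ c α 0 := by
  have := b_nonneg h0 h1 0
  simp only [c, a_zero h1]
  linarith

theorem b_add_two_le_c {α : ℝ} (h0 : 0 ≤ α) (h1 : α ≤ 0.3624) (i : ℕ) :
    b α (i + 2) ≤ c α i := by
  have h2 : α ≤ 1 / 2 := by norm_num at h1 ⊢; linarith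
  have h3 : α < 1 := by linarith
  have i1 := b_le_a_sub_a h0 h2 (l := i + 2) (by omega)
  have i2 := a_nonneg h3 (i + 2 + 2)
  rcases Nat.eq_zero_or_pos i with rfl | hi
  · have := a_antitone h0 h3 (show 0 ≤ 0 + 2 + 1 by omega)
    rw [a_zero h3] at this
    have := one_le_c_zero h0 h3
    linarith
  · have := a_succ_le_c h0 h2 (s := i + 1) (by omega)
    have := c_succ_le h0 h1 i
    have := a_succ_le h0 h3 (i + 2)
    linarith


/-! ### Quadratic forms of diagonally dominant matrices. -/

theorem sum_sum_offdiag_comm {n : Type*} [Fintype n] [DecidableEq n] (f : n → n → ℝ) :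
    ∑ i, ∑ j ∈ Finset.univ.erase i, f i j = ∑ i, ∑ j ∈ Finset.univ.erase i, f j i := by
  refine Finset.sum_comm' ?_
  intro x y
  simp [eq_comm]

/-- A matrix that is weakly diagonally dominant in the average of rows and columns has a
nonnegative quadratic form. -/
theorem dotProduct_mulVec_nonneg_of_dominant {n : Type*} [Fintype n] [DecidableEq n]
    (A : Matrix n n ℝ)
    (hA : ∀ i, ∑ j ∈ Finset.univ.erase i, |A i j| + ∑ j ∈ Finset.univ.erase i, |A j i|
      ≤ 2 * A i i) (x : n → ℝ) : 0 ≤ x ⬝ᵥ A.mulVec x := by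
  have e : x ⬝ᵥ A.mulVec x
      = ∑ i, (A i i * x i ^ 2 + ∑ j ∈ Finset.univ.erase i, x i * (A i j * x j)) := by
    simp only [dotProduct, Matrix.mulVec, Finset.mul_sum]
    refine Finset.sum_congr rfl fun i _ => ?_
    rw [← Finset.add_sum_erase _ _ (Finset.mem_univ i)]
    ring
  have h1 : ∀ i j, -(|A i j| * x i ^ 2 / 2 + |A i j| * x j ^ 2 / 2) ≤ x i * (A i j * x j) := by
    intro i j
    have h2 : |x i * x j| ≤ (x i ^ 2 + x j ^ 2) / 2 := by
      rw [abs_le]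
      constructor <;> nlinarith [sq_nonneg (x i + x j), sq_nonneg (x i - x j)]
    have h3 := neg_abs_le (A i j * (x i * x j))
    rw [abs_mul] at h3
    have := mul_le_mul_of_nonneg_left h2 (abs_nonneg (A i j))
    linarith
  have h4 : ∑ i, ∑ j ∈ Finset.univ.erase i, |A i j| * x j ^ 2 / 2
      = ∑ i, ∑ j ∈ Finset.univ.erase i, |A j i| * x i ^ 2 / 2 :=
    sum_sum_offdiag_comm fun i j => |A i j| * x j ^ 2 / 2
  have h5 : -(∑ i, ∑ j ∈ Finset.univ.erase i, |A i j| * x i ^ 2 / 2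
      + ∑ i, ∑ j ∈ Finset.univ.erase i, |A i j| * x j ^ 2 / 2)
      ≤ ∑ i, ∑ j ∈ Finset.univ.erase i, x i * (A i j * x j) := by
    rw [← Finset.sum_add_distrib, ← Finset.sum_neg_distrib]
    refine Finset.sum_le_sum fun i _ => ?_
    rw [← Finset.sum_add_distrib, ← Finset.sum_neg_distrib]
    exact Finset.sum_le_sum fun j _ => h1 i j
  rw [h4, ← Finset.sum_add_distrib] at h5
  rw [e, Finset.sum_add_distrib]
  have h6 : ∑ i, (∑ j ∈ Finset.univ.erase i, |A i j| * x i ^ 2 / 2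
      + ∑ j ∈ Finset.univ.erase i, |A j i| * x i ^ 2 / 2) ≤ ∑ i, A i i * x i ^ 2 := by
    refine Finset.sum_le_sum fun i _ => ?_
    have := mul_le_mul_of_nonneg_right (hA i) (sq_nonneg (x i))
    simp only [← Finset.sum_div, ← Finset.sum_mul]
    linarith
  linarith

theorem symm_dotProduct_mulVec_nonneg_of_dominant {n : Type*} [Fintype n] [DecidableEq n]
    (A : Matrix n n ℝ) (hs : ∀ i j, A i j = A j i)
    (hA : ∀ i, ∑ j ∈ Finset.univ.erase i, |A i j| ≤ A i i) (x : n → ℝ) :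
    0 ≤ x ⬝ᵥ A.mulVec x := by
  refine dotProduct_mulVec_nonneg_of_dominant A (fun i => ?_) x
  simp only [hs _ i]
  linarith [hA i]

/-- The quadratic form of a symmetric matrix in terms of its row sums and off-diagonal entries. -/
theorem dotProduct_mulVec_eq_rowSum {n : Type*} [Fintype n] (A : Matrix n n ℝ)
    (hs : ∀ i j, A i j = A j i) (x : n → ℝ) :
    x ⬝ᵥ A.mulVec x
      = ∑ i, (∑ j, A i j) * x i ^ 2 + ∑ i, ∑ j, -A i j * (x i - x j) ^ 2 / 2 := by
  have e1 : ∑ i, ∑ j, A i j * x j ^ 2 / 2 = ∑ i, ∑ j, A i j * x i ^ 2 / 2 := by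
    rw [Finset.sum_comm]
    exact Finset.sum_congr rfl fun i _ => Finset.sum_congr rfl fun j _ => by rw [hs]
  have e2 : ∑ i, ∑ j, -A i j * (x i - x j) ^ 2 / 2
      = ∑ i, ∑ j, x i * (A i j * x j) - ∑ i, ∑ j, A i j * x i ^ 2 / 2
        - ∑ i, ∑ j, A i j * x j ^ 2 / 2 := by
    simp only [← Finset.sum_sub_distrib]
    refine Finset.sum_congr rfl fun i _ => Finset.sum_congr rfl fun j _ => by ring
  rw [e2, e1]
  simp only [dotProduct, Matrix.mulVec, Finset.mul_sum, Finset.sum_mul, ← Finset.sum_sub_distrib,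
    ← Finset.sum_add_distrib]
  refine Finset.sum_congr rfl fun i _ => Finset.sum_congr rfl fun j _ => by ring

/-- A symmetric matrix with nonpositive off-diagonal entries, nonnegative row sums, positive first
row sum and nonzero subdiagonal is positive definite. -/
theorem posDef_of_rowSum {m : ℕ} (A : Matrix (Fin m) (Fin m) ℝ) (hs : ∀ i j, A i j = A j i)
    (hoff : ∀ i j, i ≠ j → A i j ≤ 0) (hrow : ∀ i, 0 ≤ ∑ j, A i j)
    (hfirst : ∀ i : Fin m, (i : ℕ) = 0 → 0 < ∑ j, A i j)
    (hsub : ∀ i j : Fin m, (j : ℕ) = i + 1 → A i j < 0) : A.PosDef := by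
  refine Matrix.PosDef.of_dotProduct_mulVec_pos ?_ fun x hx => ?_
  · ext i j
    simp [hs j i]
  · have t1 : ∀ i, 0 ≤ (∑ j, A i j) * x i ^ 2 := fun i => mul_nonneg (hrow i) (sq_nonneg _)
    have t2 : ∀ i j, 0 ≤ -A i j * (x i - x j) ^ 2 / 2 := by
      intro i j
      by_cases hij : i = j
      · simp [hij]
      · have := mul_nonneg (neg_nonneg.2 (hoff i j hij)) (sq_nonneg (x i - x j))
        linarith
    have t3 : ∀ i, 0 ≤ ∑ j, -A i j * (x i - x j) ^ 2 / 2 :=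
      fun i => Finset.sum_nonneg fun j _ => t2 i j
    have p1 := Finset.sum_nonneg fun i (_ : i ∈ Finset.univ) => t1 i
    have p2 := Finset.sum_nonneg fun i (_ : i ∈ Finset.univ) => t3 i
    rw [star_trivial, dotProduct_mulVec_eq_rowSum A hs]
    refine lt_of_le_of_ne (add_nonneg p1 p2) fun h0 => hx ?_
    have z1 : ∑ i, (∑ j, A i j) * x i ^ 2 = 0 := by linarith
    have z2 : ∑ i, ∑ j, -A i j * (x i - x j) ^ 2 / 2 = 0 := by linarith
    rw [Finset.sum_eq_zero_iff_of_nonneg fun i _ => t1 i] at z1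
    rw [Finset.sum_eq_zero_iff_of_nonneg fun i _ => t3 i] at z2
    -- Both sums vanish termwise: the first row sum forces `x 0 = 0`, and the nonzero subdiagonal
    -- carries this from `k` to `k + 1`.
    have key : ∀ k (hk : k < m), x ⟨k, hk⟩ = 0 := by
      intro k
      induction k with
      | zero =>
        intro hk
        have := z1 ⟨0, hk⟩ (Finset.mem_univ _)
        rcases mul_eq_zero.1 this with h | h
        · exact absurd h (hfirst _ rfl).ne'
        · exact pow_eq_zero_iff (by norm_num) |>.1 h
      | succ k ih =>
        intro hk
        have h1 := ih (by omega)
        have h2 := z2 ⟨k, by omega⟩ (Finset.mem_univ _)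
        rw [Finset.sum_eq_zero_iff_of_nonneg fun j _ => t2 _ j] at h2
        have h3 := h2 ⟨k + 1, hk⟩ (Finset.mem_univ _)
        have h4 := hsub ⟨k, by omega⟩ ⟨k + 1, hk⟩ rfl
        rw [h1, zero_sub, neg_sq, div_eq_zero_iff, mul_eq_zero] at h3
        rcases h3 with (h | h) | h
        · linarith
        · exact pow_eq_zero_iff (by norm_num) |>.1 h
        · norm_num at h
    ext i
    exact key i i.2

/-! ### The difference coefficients `g_k`. -/

theorem g_neg (β : ℝ) (k : ℤ) : g β (-k) = g β k := by
  simp only [g]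
  push_cast
  have e1 : β / 2 - -(k : ℝ) + 1 = β / 2 + k + 1 := by ring
  have e2 : β / 2 + -(k : ℝ) + 1 = β / 2 - k + 1 := by ring
  have e3 : (-1 : ℝ) ^ (-k) = (-1) ^ k := by
    rw [zpow_neg, ← inv_zpow]; norm_num
  rw [e1, e2, e3, mul_comm (Real.Gamma (β / 2 + k + 1))]

theorem g_zero_pos {β : ℝ} (h1 : 1 < β) : 0 < g β 0 := by
  have i1 := Real.Gamma_pos_of_pos (by linarith : 0 < 1 + β)
  have i2 := Real.Gamma_pos_of_pos (by linarith : 0 < β / 2 + 1)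
  simp only [g, zpow_zero, Int.cast_zero, sub_zero, add_zero, one_mul]
  positivity

theorem g_succ {β : ℝ} (h1 : 1 < β) (k : ℕ) :
    (k + 1 + β / 2) * g β ((k + 1 : ℕ) : ℤ) = (k - β / 2) * g β (k : ℤ) := by
  have hk : (0 : ℝ) ≤ k := Nat.cast_nonneg k
  have e1 : Real.Gamma (β / 2 + ((k + 1 : ℕ) : ℝ) + 1)
      = (k + 1 + β / 2) * Real.Gamma (β / 2 + k + 1) := by
    rw [Real.Gamma_add_one (by push_cast; linarith)]
    push_cast
    ring_nf
  have hne : (k : ℝ) + 1 + β / 2 ≠ 0 := by linarith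
  simp only [g, Int.cast_natCast, zpow_natCast]
  rw [e1, show β / 2 - ((k + 1 : ℕ) : ℝ) + 1 = β / 2 - k by push_cast; ring]
  -- At `k = β / 2` the convention `Γ(0) = 0` makes the left side zero, in agreement with the factor
  -- on the right.
  by_cases hz : β / 2 - (k : ℝ) = 0
  · rw [hz, Real.Gamma_zero, show (k : ℝ) - β / 2 = 0 by linarith]
    simp
  · rw [Real.Gamma_add_one hz, pow_succ]
    have hG2 := (Real.Gamma_pos_of_pos (by linarith : 0 < β / 2 + k + 1)).ne'
    rw [show (k : ℝ) - β / 2 = -(β / 2 - k) by ring]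
    generalize Real.Gamma (β / 2 + k + 1) = y at *
    generalize Real.Gamma (β / 2 - k) = z
    generalize β / 2 - (k : ℝ) = d at *
    rcases eq_or_ne z 0 with rfl | hG
    · simp
    · field_simp

/-- The absolute values of the off-diagonal difference coefficients. -/
def gAbs (β : ℝ) (k : ℕ) : ℝ := -g β (k : ℤ)

theorem gAbs_succ {β : ℝ} (h1 : 1 < β) (k : ℕ) :
    (k + 1 + β / 2) * gAbs β (k + 1) = (k - β / 2) * gAbs β k := by
  have := g_succ h1 k
  simp only [gAbs]
  linarith

theorem gAbs_one_pos {β : ℝ} (h1 : 1 < β) : 0 < gAbs β 1 := by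
  have i1 := gAbs_succ h1 0
  have i2 := g_zero_pos h1
  simp only [gAbs, Nat.cast_zero] at i1
  by_contra hc
  simp only [gAbs] at hc
  have := mul_pos (by linarith : 0 < β / 2) i2
  have := mul_nonneg (by linarith : 0 ≤ 1 + β / 2) (by linarith : 0 ≤ g β ((0 + 1 : ℕ) : ℤ))
  simp at *
  linarith

theorem gAbs_nonneg {β : ℝ} (h1 : 1 < β) (h2 : β ≤ 2) {k : ℕ} (hk : 1 ≤ k) : 0 ≤ gAbs β k := by
  induction k, hk using Nat.le_induction with
  | base => exact (gAbs_one_pos h1).le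
  | succ k hk ih =>
    have hk' : (1 : ℝ) ≤ k := by exact_mod_cast hk
    have := gAbs_succ h1 k
    have h3 := mul_nonneg (by linarith : 0 ≤ (k : ℝ) - β / 2) ih
    rw [← this] at h3
    exact nonneg_of_mul_nonneg_right h3 (by linarith)

theorem gAbs_succ_le {β : ℝ} (h1 : 1 < β) (h2 : β ≤ 2) {k : ℕ} (hk : 1 ≤ k) :
    gAbs β (k + 1) ≤ gAbs β k := by
  have hk' : (1 : ℝ) ≤ k := by exact_mod_cast hk
  have i1 := gAbs_succ h1 k
  have i2 := gAbs_nonneg h1 h2 hk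
  refine le_of_mul_le_mul_left (a := (k : ℝ) + 1 + β / 2) ?_ (by linarith)
  rw [i1]
  exact mul_le_mul_of_nonneg_right (by linarith) i2

theorem gAbs_anti {β : ℝ} (h1 : 1 < β) (h2 : β ≤ 2) {k l : ℕ} (hk : 1 ≤ k) (hkl : k ≤ l) :
    gAbs β l ≤ gAbs β k := by
  induction l, hkl using Nat.le_induction with
  | base => exact le_rfl
  | succ l hl ih => exact (gAbs_succ_le h1 h2 (hk.trans hl)).trans ih

theorem gAbs_two_lt {β : ℝ} (h1 : 1 < β) : gAbs β 2 < gAbs β 1 := by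
  have i1 := gAbs_succ h1 1
  have i2 := gAbs_one_pos h1
  push_cast at i1
  refine lt_of_mul_lt_mul_left (a := (1 : ℝ) + 1 + β / 2) ?_ (by linarith)
  rw [i1]
  exact mul_lt_mul_of_pos_right (by linarith) i2

/-- The recursion for consecutive coefficients makes the sum telescope; the subtracted term is the
tail, nonnegative for `m ≥ 1`. -/
theorem sum_gAbs_eq {β : ℝ} (h1 : 1 < β) (m : ℕ) :
    ∑ k ∈ Finset.Icc 1 m, gAbs β k = g β 0 / 2 - gAbs β m * (m - β / 2) / β := by
  have hβ : β ≠ 0 := by linarith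
  induction m with
  | zero => simp [gAbs]; field_simp; ring
  | succ m ih =>
    rw [Finset.sum_Icc_succ_top (by omega), ih]
    have := gAbs_succ h1 m
    push_cast
    field_simp
    linarith

theorem sum_gAbs_le {β : ℝ} (h1 : 1 < β) (h2 : β ≤ 2) (m : ℕ) :
    ∑ k ∈ Finset.Icc 1 m, gAbs β k ≤ g β 0 / 2 := by
  rcases Nat.eq_zero_or_pos m with rfl | hm
  · have := g_zero_pos h1
    simp; linarith
  · have hm' : (1 : ℝ) ≤ m := by exact_mod_cast hm
    rw [sum_gAbs_eq h1]
    have := div_nonneg (mul_nonneg (gAbs_nonneg h1 h2 hm) (by linarith : 0 ≤ (m : ℝ) - β / 2))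
      (by linarith : 0 ≤ β)
    linarith


/-! ### The matrices `G_β`, `H_β` and `G_τ`. -/

theorem sum_add_sum_le_sum_of_injOn {ι : Type*} (s₁ s₂ : Finset ι) (φ₁ φ₂ : ι → ℕ) (t : Finset ℕ)
    (p : ℕ → ℝ) (hp : ∀ k ∈ t, 0 ≤ p k) (inj₁ : Set.InjOn φ₁ s₁) (inj₂ : Set.InjOn φ₂ s₂)
    (hd : ∀ x ∈ s₁, ∀ y ∈ s₂, φ₁ x ≠ φ₂ y) (m₁ : ∀ x ∈ s₁, φ₁ x ∈ t) (m₂ : ∀ x ∈ s₂, φ₂ x ∈ t) :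
    ∑ x ∈ s₁, p (φ₁ x) + ∑ x ∈ s₂, p (φ₂ x) ≤ ∑ k ∈ t, p k := by
  classical
  rw [← Finset.sum_image (f := p) inj₁, ← Finset.sum_image (f := p) inj₂, ← Finset.sum_union]
  · refine Finset.sum_le_sum_of_subset_of_nonneg ?_ fun k hk _ => hp k hk
    intro k hk
    simp only [Finset.mem_union, Finset.mem_image] at hk
    rcases hk with ⟨x, hx, rfl⟩ | ⟨x, hx, rfl⟩
    · exact m₁ x hx
    · exact m₂ x hx
  · rw [Finset.disjoint_left]
    intro k hk hk'
    simp only [Finset.mem_image] at hk hk'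
    obtain ⟨x, hx, rfl⟩ := hk
    obtain ⟨y, hy, e⟩ := hk'
    exact hd x hx y hy e.symm

/-- The absolute value of the off-diagonal Toeplitz entry. -/
def toeplitzAbs (β : ℝ) (i j : ℕ) : ℝ :=
  (if j < i then gAbs β (i - j) else 0) + (if i < j then gAbs β (j - i) else 0)

/-- The absolute value of the Hankel entry. -/
def hankelAbs (β : ℝ) (N i j : ℕ) : ℝ :=
  (if i + j + 4 ≤ N then gAbs β (i + j + 2) else 0)
    + (if N < i + j + 1 then gAbs β (2 * N - (i + j + 2)) else 0)

theorem Gbeta_diag (β : ℝ) (N : ℕ) (i : Fin (N - 1)) : Gbeta β N i i = g β 0 := by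
  simp [Gbeta]

theorem Gbeta_offdiag (β : ℝ) (N : ℕ) {i j : Fin (N - 1)} (hij : i ≠ j) :
    Gbeta β N i j = -toeplitzAbs β i j := by
  have hij' : (i : ℕ) ≠ j := fun h => hij (Fin.ext h)
  simp only [Gbeta, Matrix.of_apply, toeplitzAbs, gAbs]
  rcases lt_or_gt_of_ne hij' with h | h
  · rw [if_neg (by omega), if_pos h, ← g_neg]
    simp only [zero_add, neg_neg]
    congr 1
    omega
  · rw [if_pos h, if_neg (by omega)]
    simp only [add_zero, neg_neg]
    congr 1
    omega

theorem Hbeta_eq (β : ℝ) (N : ℕ) (i j : Fin (N - 1)) :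
    Hbeta β N i j = -hankelAbs β N i j := by
  have hi := i.2
  have hj := j.2
  simp only [Hbeta, Matrix.of_apply, hankelEntry, hankelAbs, gAbs]
  by_cases h1 : (i : ℕ) + j + 4 ≤ N
  · rw [if_pos (by omega), if_pos h1, if_neg (by omega)]
    simp only [add_zero, neg_neg]
    congr 1
    push_cast
    ring
  · rw [if_neg (by omega), if_neg h1]
    by_cases h2 : N < (i : ℕ) + j + 1
    · rw [if_neg (by omega), if_pos h2]
      simp only [zero_add, neg_neg]
      congr 1
      omega
    · rw [if_pos (by omega), if_neg h2]
      simp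

theorem toeplitzAbs_symm (β : ℝ) (i j : ℕ) : toeplitzAbs β i j = toeplitzAbs β j i := by
  rw [toeplitzAbs, toeplitzAbs, add_comm]

theorem toeplitzAbs_self (β : ℝ) (i : ℕ) : toeplitzAbs β i i = 0 := by
  simp [toeplitzAbs]

theorem hankelAbs_symm (β : ℝ) (N i j : ℕ) : hankelAbs β N i j = hankelAbs β N j i := by
  rw [hankelAbs, hankelAbs, add_comm i j]

theorem hankelAbs_nonneg {β : ℝ} (h1 : 1 < β) (h2 : β ≤ 2) {N i j : ℕ} (_ : i < N - 1)
    (_ : j < N - 1) : 0 ≤ hankelAbs β N i j := by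
  refine add_nonneg ?_ ?_ <;> split_ifs
  · exact gAbs_nonneg h1 h2 (by omega)
  · exact le_rfl
  · exact gAbs_nonneg h1 h2 (by omega)
  · exact le_rfl

/-- A nonzero Hankel entry has index `s` or `2N - s` with `s = i + j + 2`, and `gAbs` decreases. It
is applied with `k = |i - j|` and with `k = 2`. -/
theorem hankelAbs_le {β : ℝ} (h1 : 1 < β) (h2 : β ≤ 2) {N i j k : ℕ} (hk : 1 ≤ k) (hk1 : k ≤ i + j + 2) (hk2 : k + (i + j + 2) ≤ 2 * N) :
    hankelAbs β N i j ≤ gAbs β k := by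
  have h0 := gAbs_nonneg h1 h2 hk
  rw [hankelAbs]
  by_cases c1 : i + j + 4 ≤ N
  · rw [if_pos c1, if_neg (by omega), add_zero]
    exact gAbs_anti h1 h2 hk hk1
  · rw [if_neg c1, zero_add]
    split_ifs with c2
    · exact gAbs_anti h1 h2 hk (by omega)
    · exact h0

theorem hankelAbs_le_toeplitzAbs {β : ℝ} (h1 : 1 < β) (h2 : β ≤ 2) {N i j : ℕ} (hi : i < N - 1)
    (hj : j < N - 1) (hij : i ≠ j) : hankelAbs β N i j ≤ toeplitzAbs β i j := by
  rw [toeplitzAbs]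
  rcases lt_or_gt_of_ne hij with h | h
  · rw [if_neg (by omega), if_pos h, zero_add]
    exact hankelAbs_le h1 h2 (by omega) (by omega) (by omega)
  · rw [if_pos h, if_neg (by omega), add_zero]
    exact hankelAbs_le h1 h2 (by omega) (by omega) (by omega)

theorem sum_toeplitzAbs_add_hankelAbs_le {β : ℝ} (h1 : 1 < β) (h2 : β ≤ 2) {N : ℕ}
    (i : Fin (N - 1)) :
    ∑ j : Fin (N - 1), toeplitzAbs β i j + ∑ j : Fin (N - 1), hankelAbs β N i j
      ≤ g β 0 - gAbs β (i + 1) := by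
  have hi := i.2
  have hp : ∀ k ∈ Finset.Icc 1 N, 0 ≤ gAbs β k := fun k hk =>
    gAbs_nonneg h1 h2 (Finset.mem_Icc.1 hk).1
  -- Toeplitz indices `1, …, i` and Hankel indices `i + 2, …, N - 2` are disjoint and skip `i + 1`;
  -- this gap is the slack `gAbs β (i + 1)` that makes the first row sum of `G_τ` positive.
  have left := sum_add_sum_le_sum_of_injOn
    (Finset.univ.filter fun j : Fin (N - 1) => (j : ℕ) < i)
    (Finset.univ.filter fun j : Fin (N - 1) => (i : ℕ) + j + 4 ≤ N)
    (fun j => (i : ℕ) - j) (fun j => (i : ℕ) + j + 2) ((Finset.Icc 1 N).erase (i + 1)) (gAbs β)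
    (fun k hk => hp k (Finset.mem_of_mem_erase hk))
    (fun x hx y hy h => by simp at hx hy h; omega)
    (fun x hx y hy h => by simp at hx hy h; omega)
    (fun x hx y hy h => by simp at hx hy h; omega)
    (fun x hx => by simp at hx ⊢; omega)
    (fun x hx => by simp at hx ⊢; omega)
  have right := sum_add_sum_le_sum_of_injOn
    (Finset.univ.filter fun j : Fin (N - 1) => (i : ℕ) < j)
    (Finset.univ.filter fun j : Fin (N - 1) => N < (i : ℕ) + j + 1)
    (fun j => (j : ℕ) - i) (fun j => 2 * N - ((i : ℕ) + j + 2)) (Finset.Icc 1 N) (gAbs β) hp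
    (fun x hx y hy h => by simp at hx hy h; omega)
    (fun x hx y hy h => by simp at hx hy h; omega)
    (fun x hx y hy h => by simp at hx hy h; omega)
    (fun x hx => by simp at hx ⊢; omega)
    (fun x hx => by simp at hx ⊢; omega)
  have hmem : (i : ℕ) + 1 ∈ Finset.Icc 1 N := by simp; omega
  have e := Finset.add_sum_erase _ (gAbs β) hmem
  have hs := sum_gAbs_le h1 h2 N
  simp only [Finset.sum_filter] at left right
  simp only [toeplitzAbs, hankelAbs, Finset.sum_add_distrib]
  linarith

theorem Gbeta_symm (β : ℝ) (N : ℕ) (i j : Fin (N - 1)) : Gbeta β N i j = Gbeta β N j i := by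
  by_cases h : i = j
  · rw [h]
  · rw [Gbeta_offdiag β N h, Gbeta_offdiag β N (Ne.symm h), toeplitzAbs_symm]

theorem Hbeta_symm (β : ℝ) (N : ℕ) (i j : Fin (N - 1)) : Hbeta β N i j = Hbeta β N j i := by
  rw [Hbeta_eq, Hbeta_eq, hankelAbs_symm]

theorem Gtau_posDef {β : ℝ} (h1 : 1 < β) (h2 : β ≤ 2) (N : ℕ) : (Gtau β N).PosDef := by
  have hrow : ∀ i : Fin (N - 1), gAbs β (i + 1) ≤ ∑ j, Gtau β N i j := by
    intro i
    have hi := sum_toeplitzAbs_add_hankelAbs_le h1 h2 i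
    have e : ∑ j, Gtau β N i j = g β 0 - ∑ j : Fin (N - 1), toeplitzAbs β i j
        + ∑ j : Fin (N - 1), hankelAbs β N i j := by
      rw [← Finset.add_sum_erase _ _ (Finset.mem_univ i),
        ← Finset.add_sum_erase _ (fun j : Fin (N - 1) => toeplitzAbs β i j) (Finset.mem_univ i),
        ← Finset.add_sum_erase _ (fun j : Fin (N - 1) => hankelAbs β N i j) (Finset.mem_univ i)]
      have : ∑ j ∈ Finset.univ.erase i, Gtau β N i j
          = ∑ j ∈ Finset.univ.erase i, (hankelAbs β N i j - toeplitzAbs β i j) := by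
        refine Finset.sum_congr rfl fun j hj => ?_
        rw [Gtau, Matrix.sub_apply, Gbeta_offdiag β N (Finset.ne_of_mem_erase hj).symm, Hbeta_eq]
        ring
      rw [this, Finset.sum_sub_distrib, Gtau, Matrix.sub_apply, Gbeta_diag, Hbeta_eq,
        toeplitzAbs_self]
      ring
    have := Finset.sum_nonneg fun j (_ : j ∈ Finset.univ) =>
      hankelAbs_nonneg h1 h2 i.2 (j : Fin (N - 1)).2
    linarith
  refine posDef_of_rowSum _ ?_ ?_ ?_ ?_ ?_
  · intro i j
    rw [Gtau, Matrix.sub_apply, Matrix.sub_apply, Gbeta_symm, Hbeta_symm]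
  · intro i j hij
    rw [Gtau, Matrix.sub_apply, Gbeta_offdiag β N hij, Hbeta_eq]
    have := hankelAbs_le_toeplitzAbs h1 h2 i.2 j.2 (fun h => hij (Fin.ext h))
    linarith
  · exact fun i => (gAbs_nonneg h1 h2 (by omega)).trans (hrow i)
  · intro i hi
    have := hrow i
    rw [hi] at this
    exact (gAbs_one_pos h1).trans_le this
  · intro i j hij
    have hi := i.2
    have hj := j.2
    rw [Gtau, Matrix.sub_apply, Gbeta_offdiag β N (fun h => by rw [h] at hij; omega), Hbeta_eq]
    have i1 := hankelAbs_le h1 h2 (N := N) (i := i) (j := j) (k := 2) (by omega) (by omega) (by omega)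
    have i2 := gAbs_two_lt h1
    rw [toeplitzAbs, if_neg (by omega), if_pos (by omega), hij]
    rw [hij] at i1
    simp only [Nat.add_sub_cancel_left]
    linarith

theorem abs_Hbeta_quadratic_le {β : ℝ} (h1 : 1 < β) (h2 : β ≤ 2) (N : ℕ) (x : Fin (N - 1) → ℝ) :
    |x ⬝ᵥ (Hbeta β N).mulVec x| ≤ (x ⬝ᵥ (Gtau β N).mulVec x) / 2 := by
  -- `3H ≤ G` and `-H ≤ G` are equivalent to `±H ≤ (G - H) / 2`. For both values of `μ`, the
  -- inequality `0 ≤ hankelAbs ≤ toeplitzAbs` bounds off-diagonal entries by their sum.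
  have key : ∀ μ : ℝ, μ = 3 ∨ μ = -1 →
      0 ≤ x ⬝ᵥ (Gbeta β N - μ • Hbeta β N).mulVec x := by
    intro μ hμ
    refine symm_dotProduct_mulVec_nonneg_of_dominant _ (fun i j => ?_) (fun i => ?_) x
    · simp only [Matrix.sub_apply, Matrix.smul_apply]
      rw [Gbeta_symm, Hbeta_symm]
    · have hi := sum_toeplitzAbs_add_hankelAbs_le h1 h2 i
      have h3 := gAbs_nonneg h1 h2 (k := i + 1) (by omega)
      have h4 := hankelAbs_nonneg h1 h2 i.2 i.2
      rw [← Finset.add_sum_erase _ (fun j : Fin (N - 1) => toeplitzAbs β i j) (Finset.mem_univ i),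
        ← Finset.add_sum_erase _ (fun j : Fin (N - 1) => hankelAbs β N i j) (Finset.mem_univ i),
        toeplitzAbs_self] at hi
      have h5 : ∑ j ∈ Finset.univ.erase i, |(Gbeta β N - μ • Hbeta β N) i j|
          ≤ ∑ j ∈ Finset.univ.erase i, (toeplitzAbs β i j + hankelAbs β N i j) := by
        refine Finset.sum_le_sum fun j hj => ?_
        have hji := Finset.ne_of_mem_erase hj
        have b1 := hankelAbs_nonneg h1 h2 i.2 j.2
        have b2 := hankelAbs_le_toeplitzAbs h1 h2 i.2 j.2 (fun h => hji (Fin.ext h).symm)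
        rw [Matrix.sub_apply, Matrix.smul_apply, Gbeta_offdiag β N hji.symm, Hbeta_eq, smul_eq_mul,
          abs_le]
        rcases hμ with rfl | rfl <;> constructor <;> linarith
      rw [Finset.sum_add_distrib] at h5
      refine h5.trans ?_
      rw [Matrix.sub_apply, Matrix.smul_apply, Gbeta_diag, Hbeta_eq, smul_eq_mul]
      rcases hμ with rfl | rfl <;> linarith
  have k1 := key 3 (Or.inl rfl)
  have k2 := key (-1) (Or.inr rfl)
  simp only [Matrix.sub_mulVec, Matrix.smul_mulVec, dotProduct_sub, dotProduct_smul,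
    smul_eq_mul] at k1 k2
  rw [Gtau, Matrix.sub_mulVec, dotProduct_sub, abs_le]
  constructor <;> linarith

/-! ### Nonnegativity of the quadratic form of `A_t`. -/

theorem sum_erase_le_of_telescoping {m : ℕ} (f : Fin m → ℝ) (w : ℕ → ℝ) (i : Fin m)
    (hi : w (i + 1) ≤ w i) (h : ∀ j, j ≠ i → f j ≤ w j - w (j + 1)) :
    ∑ j ∈ Finset.univ.erase i, f j ≤ w 0 - w m := by
  calc ∑ j ∈ Finset.univ.erase i, f j
      ≤ ∑ j ∈ Finset.univ.erase i, (w j - w (j + 1)) :=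
        Finset.sum_le_sum fun j hj => h j (Finset.ne_of_mem_erase hj)
    _ ≤ ∑ j : Fin m, (w j - w (j + 1)) := by
        rw [← Finset.add_sum_erase _ (fun j : Fin m => w j - w (j + 1)) (Finset.mem_univ i)]
        linarith
    _ = w 0 - w m := by
        rw [Fin.sum_univ_eq_sum_range (fun j => w j - w (j + 1)) m, Finset.sum_range_sub']

/-- The matrix `A_t` without its positive scalar factor. -/
def AtCore (α : ℝ) (M : ℕ) : Matrix (Fin (M - 1)) (Fin (M - 1)) ℝ :=
  Matrix.of fun i j =>
    if (i : ℕ) < (j : ℕ) then 0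
    else if (j : ℕ) = 0 then
      (if (i : ℕ) = 0 then cTilde α 0 else cTilde α (i : ℕ) - c α ((i : ℕ) - 1))
    else if (i : ℕ) = (j : ℕ) then c α 0
    else c α ((i : ℕ) - (j : ℕ)) - c α ((i : ℕ) - (j : ℕ) - 1)

theorem At_eq_smul (α β h τ : ℝ) (M : ℕ) :
    At α β h τ M = (h ^ β * τ ^ (-α) / Real.Gamma (2 - α)) • AtCore α M := rfl

section AtCore

variable {α : ℝ} {M : ℕ}

theorem AtCore_upper {i j : Fin (M - 1)} (h : (i : ℕ) < j) : AtCore α M i j = 0 := by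
  simp only [AtCore, Matrix.of_apply]
  rw [if_pos h]

theorem abs_AtCore_toeplitz (h0 : 0 ≤ α) (h1 : α ≤ 0.3624) {i j : Fin (M - 1)}
    (h : (j : ℕ) < i) (hj : (j : ℕ) ≠ 0) :
    |AtCore α M i j| = c α (i - j - 1) - c α (i - j) := by
  have e : AtCore α M i j = c α (i - j) - c α (i - j - 1) := by
    simp only [AtCore, Matrix.of_apply]
    rw [if_neg (by omega), if_neg hj, if_neg (by omega)]
  rw [e, abs_sub_comm, abs_of_nonneg (sub_nonneg.2 (c_antitone h0 h1 (Nat.sub_le _ _)))]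

theorem AtCore_first {i j : Fin (M - 1)} (hi : (i : ℕ) ≠ 0) (hj : (j : ℕ) = 0) :
    AtCore α M i j = c α i - c α (i - 1) + b α (i + 1) := by
  simp only [AtCore, Matrix.of_apply]
  rw [if_neg (by omega), if_pos hj, if_neg hi]
  obtain ⟨k, hk⟩ := Nat.exists_eq_succ_of_ne_zero hi
  rw [hk]
  simp only [Nat.succ_eq_add_one, cTilde, c, Nat.add_sub_cancel]
  ring

theorem AtCore_row_le (h0 : 0 ≤ α) (h1 : α ≤ 0.3624) (i : Fin (M - 1)) (hi : (i : ℕ) ≠ 0) :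
    ∑ j ∈ Finset.univ.erase i, |AtCore α M i j| ≤ c α 0 := by
  have hlt := i.2
  -- The value `0` at `j = 0` allots `c (i - 1)` to the first-column entry. Truncated subtraction
  -- makes the weight constant from the diagonal on, where the row is zero.
  refine (sum_erase_le_of_telescoping _ (fun j => if j = 0 then 0 else -c α (i - j)) i ?_ ?_).trans
    ?_
  · simp [hi]
  · intro j hj
    have hj' : (j : ℕ) ≠ i := fun h => hj (Fin.ext h)
    simp only [Nat.add_eq_zero_iff, one_ne_zero, and_false, if_false]
    rcases lt_or_gt_of_ne hj' with h | h
    · by_cases hz : (j : ℕ) = 0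
      · rw [AtCore_first hi hz, if_pos hz, hz]
        have i1 := c_antitone h0 h1 (Nat.sub_le (i : ℕ) 1)
        have i2 := c_nonneg h0 h1 i
        have i3 := b_add_two_le_c h0 h1 ((i : ℕ) - 1)
        have i4 := b_nonneg h0 (by norm_num at h1; linarith) ((i : ℕ) + 1)
        rw [show (i : ℕ) - 1 + 2 = i + 1 by omega] at i3
        rw [abs_le]
        simp only [zero_add]
        constructor <;> linarith
      · rw [abs_AtCore_toeplitz h0 h1 h hz, if_neg hz, Nat.sub_sub]
        linarith
    · rw [AtCore_upper h, if_neg (by omega), abs_zero, Nat.sub_eq_zero_of_le h.le,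
        Nat.sub_eq_zero_of_le (by omega)]
      linarith
  · rw [if_pos rfl, if_neg (by omega), Nat.sub_eq_zero_of_le hlt.le]
    linarith

theorem AtCore_col_le (h0 : 0 ≤ α) (h1 : α ≤ 0.3624) (i : Fin (M - 1)) (hi : (i : ℕ) ≠ 0) :
    ∑ j ∈ Finset.univ.erase i, |AtCore α M j i| ≤ c α 0 := by
  refine (sum_erase_le_of_telescoping _ (fun j => c α (j - i - 1)) i ?_ ?_).trans ?_
  · exact c_antitone h0 h1 (by omega)
  · intro j hj
    have hj' : (j : ℕ) ≠ i := fun h => hj (Fin.ext h)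
    rcases lt_or_gt_of_ne hj' with h | h
    · rw [AtCore_upper h, abs_zero]
      exact sub_nonneg.2 (c_antitone h0 h1 (by omega))
    · rw [abs_AtCore_toeplitz h0 h1 h hi, show (j : ℕ) + 1 - i - 1 = j - i by omega]
  · have := c_nonneg h0 h1 (M - 1 - i - 1)
    simp only [Nat.zero_sub]
    linarith

/-- The bound may be `2 c_0` because the first row has no off-diagonal entries. In the weight, `c`
pays for the Toeplitz part and `a` for the extra `b`. -/
theorem AtCore_first_col_le (h0 : 0 ≤ α) (h1 : α ≤ 0.3624) (i : Fin (M - 1)) (hi : (i : ℕ) = 0) :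
    ∑ j ∈ Finset.univ.erase i, |AtCore α M j i| ≤ 2 * c α 0 := by
  have h2 : α ≤ 1 / 2 := by norm_num at h1 ⊢; linarith
  have h3 : α < 1 := by linarith
  refine (sum_erase_le_of_telescoping _ (fun j => c α (j - 1) + a α (j + 2)) i ?_ ?_).trans ?_
  · exact add_le_add (c_antitone h0 h1 (by omega)) (a_antitone h0 h3 (by omega))
  · intro j hj
    have hj' : (j : ℕ) ≠ 0 := fun h => hj (Fin.ext (h.trans hi.symm))
    rw [AtCore_first hj' hi]
    have i1 := c_antitone h0 h1 (Nat.sub_le (j : ℕ) 1)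
    have i2 := b_le_a_sub_a h0 h2 (l := (j : ℕ) + 1) (by omega)
    have i3 := b_nonneg h0 h3 ((j : ℕ) + 1)
    simp only [Nat.add_sub_cancel]
    rw [show (j : ℕ) + 1 + 1 = j + 2 by omega, show (j : ℕ) + 1 + 2 = j + 3 by omega] at i2
    rw [show (j : ℕ) + 1 + 2 = j + 3 by omega, abs_le]
    constructor <;> linarith
  · have i1 := c_nonneg h0 h1 (M - 1 - 1)
    have i2 := a_nonneg h3 (M - 1 + 2)
    have i3 := a_antitone h0 h3 (show 0 ≤ 2 by omega)
    have i4 := one_le_c_zero h0 h3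
    rw [a_zero h3] at i3
    simp only [Nat.zero_sub, zero_add]
    linarith

theorem AtCore_quadratic_nonneg (h0 : 0 ≤ α) (h1 : α ≤ 0.3624) (x : Fin (M - 1) → ℝ) :
    0 ≤ x ⬝ᵥ (AtCore α M).mulVec x := by
  refine dotProduct_mulVec_nonneg_of_dominant _ (fun i => ?_) x
  by_cases hi : (i : ℕ) = 0
  · have e1 : ∑ j ∈ Finset.univ.erase i, |AtCore α M i j| = 0 := by
      refine Finset.sum_eq_zero fun j hj => ?_
      have hj' : (j : ℕ) ≠ i := fun h => Finset.ne_of_mem_erase hj (Fin.ext h)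
      rw [AtCore_upper (by omega), abs_zero]
    have e2 : AtCore α M i i = c α 0 + b α 1 := by
      simp [AtCore, hi, cTilde, c]
    have i1 := AtCore_first_col_le h0 h1 i hi
    have i2 := b_nonneg h0 (by norm_num at h1; linarith) 1
    rw [e1, e2]
    linarith
  · have e : AtCore α M i i = c α 0 := by simp [AtCore, hi]
    have i1 := AtCore_row_le h0 h1 i hi
    have i2 := AtCore_col_le h0 h1 i hi
    rw [e]
    linarith

end AtCore

theorem At_quadratic_nonneg {α β h τ : ℝ} (h0 : 0 ≤ α) (h1 : α ≤ 0.3624) (hh : 0 ≤ h) (hτ : 0 ≤ τ)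
    (M : ℕ) (x : Fin (M - 1) → ℝ) : 0 ≤ x ⬝ᵥ (At α β h τ M).mulVec x := by
  have hG : 0 < Real.Gamma (2 - α) := Real.Gamma_pos_of_pos (by norm_num at h1; linarith)
  rw [At_eq_smul, Matrix.smul_mulVec, dotProduct_smul, smul_eq_mul]
  exact mul_nonneg (by positivity) (AtCore_quadratic_nonneg h0 h1 x)


/-! ### Spectral norm bounds and the abstract preconditioning estimate. -/

section Norm

open scoped Matrix.Norms.L2Operator

variable {n : Type*} [Fintype n] [DecidableEq n]

theorem l2_opNorm_le_of_dotProduct_le (A : Matrix n n ℝ) {r : ℝ} (hr : 0 ≤ r)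
    (h : ∀ x, A.mulVec x ⬝ᵥ A.mulVec x ≤ r ^ 2 * (x ⬝ᵥ x)) : ‖A‖ ≤ r := by
  rw [← Matrix.l2_opNorm_toEuclideanCLM]
  refine ContinuousLinearMap.opNorm_le_bound _ hr fun x => ?_
  refine (sq_le_sq₀ (norm_nonneg _) (by positivity)).1 ?_
  rw [mul_pow, EuclideanSpace.real_norm_sq_eq, EuclideanSpace.real_norm_sq_eq]
  have := h x.ofLp
  simpa [dotProduct, pow_two, Matrix.ofLp_toEuclideanCLM] using this

/-- The numerical radius of a symmetric matrix bounds its norm. -/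
theorem l2_opNorm_le_half_of_quadratic_le (K : Matrix n n ℝ) (hK : K.transpose = K)
    (h : ∀ x, |x ⬝ᵥ K.mulVec x| ≤ (x ⬝ᵥ x) / 2) : ‖K‖ ≤ 1 / 2 := by
  refine l2_opNorm_le_of_dotProduct_le K (by norm_num) fun x => ?_
  -- Polarization gives `4 y·Kx ≤ |x|² + |y|²`; the choice `y = 2Kx` turns it into `4|Kx|² ≤ |x|²`.
  set y := (2 : ℝ) • K.mulVec x with hy
  have h1 := (abs_le.1 (h (x + y))).2
  have h2 := (abs_le.1 (h (x - y))).1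
  have e1 : x ⬝ᵥ K.mulVec y = y ⬝ᵥ K.mulVec x := by
    rw [Matrix.dotProduct_mulVec, ← Matrix.mulVec_transpose, hK, dotProduct_comm]
  simp only [Matrix.mulVec_add, Matrix.mulVec_sub, dotProduct_add, add_dotProduct, dotProduct_sub,
    sub_dotProduct, e1] at h1 h2
  have e2 : y ⬝ᵥ K.mulVec x = 2 * (K.mulVec x ⬝ᵥ K.mulVec x) := by
    rw [hy, smul_dotProduct, smul_eq_mul]
  have e3 : y ⬝ᵥ y = 4 * (K.mulVec x ⬝ᵥ K.mulVec x) := by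
    rw [hy, smul_dotProduct, dotProduct_smul, smul_eq_mul, smul_eq_mul]
    ring
  rw [dotProduct_comm y x] at h1 h2
  linarith

theorem isUnit_one_add_of_accretive (B : Matrix n n ℝ) (hB : ∀ x, 0 ≤ x ⬝ᵥ B.mulVec x) :
    IsUnit (1 + B) := by
  rw [← Matrix.mulVec_injective_iff_isUnit]
  refine (injective_iff_map_eq_zero (Matrix.mulVecLin (1 + B))).2 fun x hx => ?_
  have h1 : x ⬝ᵥ (1 + B).mulVec x = 0 := by
    rw [Matrix.mulVecLin_apply] at hx
    rw [hx, dotProduct_zero]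
  rw [Matrix.add_mulVec, Matrix.one_mulVec, dotProduct_add] at h1
  have h2 : 0 ≤ x ⬝ᵥ x := dotProduct_self_star_nonneg x
  exact dotProduct_self_eq_zero.1 (by linarith [hB x])

/-- The resolvent at `-1` of a matrix with nonnegative quadratic form is a contraction. -/
theorem l2_opNorm_inv_one_add_le (B : Matrix n n ℝ) (hB : ∀ x, 0 ≤ x ⬝ᵥ B.mulVec x) :
    ‖(1 + B)⁻¹‖ ≤ 1 := by
  have hu := (Matrix.isUnit_iff_isUnit_det _).1 (isUnit_one_add_of_accretive B hB)
  refine l2_opNorm_le_of_dotProduct_le _ zero_le_one fun x => ?_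
  set y := (1 + B)⁻¹.mulVec x with hy
  have e : x = y + B.mulVec y := by
    have : (1 + B).mulVec y = x := by
      rw [hy, Matrix.mulVec_mulVec, Matrix.mul_nonsing_inv _ hu, Matrix.one_mulVec]
    rw [← this, Matrix.add_mulVec, Matrix.one_mulVec]
  have h1 := hB y
  have h2 : 0 ≤ B.mulVec y ⬝ᵥ B.mulVec y := dotProduct_self_star_nonneg _
  -- `|x|² = |y|² + 2 y·By + |By|² ≥ |y|²`.
  rw [e, add_dotProduct, dotProduct_add, dotProduct_add, dotProduct_comm (B.mulVec y) y]
  linarith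

/-- Only an inequality, since the index type may be empty, as for `N = 1` or `M = 1`. -/
theorem l2_opNorm_one_le : ‖(1 : Matrix n n ℝ)‖ ≤ 1 :=
  l2_opNorm_le_of_dotProduct_le _ zero_le_one fun x => by simp

theorem cond2_one_add_le (D : Matrix n n ℝ) (hD : ‖D‖ ≤ 1 / 2) :
    IsUnit (1 + D) ∧ cond2 (1 + D) ≤ 3 := by
  have hu : IsUnit (1 + D) := by
    have := isUnit_one_sub_of_norm_lt_one (x := -D) (by rw [norm_neg]; linarith)
    rwa [sub_neg_eq_add] at this
  refine ⟨hu, ?_⟩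
  have hdet := (Matrix.isUnit_iff_isUnit_det _).1 hu
  have h1 : ‖1 + D‖ ≤ 3 / 2 := (norm_add_le _ _).trans (by linarith [l2_opNorm_one_le (n := n)])
  have h2 : ‖(1 + D)⁻¹‖ ≤ 2 := by
    -- This identity gives `r ≤ 1 + r / 2` for `r = ‖(1 + D)⁻¹‖`, hence `r ≤ 2`.
    have e : (1 + D)⁻¹ = 1 - D * (1 + D)⁻¹ := by
      rw [eq_sub_iff_add_eq]
      nth_rewrite 1 [← one_mul (1 + D)⁻¹]
      rw [← add_mul, Matrix.mul_nonsing_inv _ hdet]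
    have h3 : ‖(1 + D)⁻¹‖ ≤ ‖(1 : Matrix n n ℝ)‖ + ‖D * (1 + D)⁻¹‖ := by
      nth_rewrite 1 [e]
      exact norm_sub_le _ _
    have h4 := norm_mul_le D (1 + D)⁻¹
    have h5 := mul_le_mul_of_nonneg_right hD (norm_nonneg (1 + D)⁻¹)
    linarith [l2_opNorm_one_le (n := n)]
  calc cond2 (1 + D) = ‖(1 + D)⁻¹‖ * ‖1 + D‖ := rfl
    _ ≤ 2 * (3 / 2) := mul_le_mul h2 h1 (norm_nonneg _) (by norm_num)
    _ = 3 := by norm_num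

/-- Two-sided preconditioning of `S² + E + A` where `A` is accretive and commutes with `S`, and `E`
is dominated by `S² / 2`. -/
theorem cond2_preconditioned_le (S A E : Matrix n n ℝ) (hS : S.transpose = S) (hSu : IsUnit S)
    (hSA : S * A = A * S) (hA : ∀ x, 0 ≤ x ⬝ᵥ A.mulVec x) (hE : E.transpose = E)
    (hES : ∀ x, |x ⬝ᵥ E.mulVec x| ≤ (x ⬝ᵥ (S * S).mulVec x) / 2) :
    IsUnit (S⁻¹ * A + S) ∧ IsUnit ((S⁻¹ * A + S)⁻¹ * (S * S + E + A) * S⁻¹) ∧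
      cond2 ((S⁻¹ * A + S)⁻¹ * (S * S + E + A) * S⁻¹) ≤ 3 := by
  have hdet := (Matrix.isUnit_iff_isUnit_det _).1 hSu
  have c1 : S * S⁻¹ = 1 := Matrix.mul_nonsing_inv _ hdet
  have c2 : S⁻¹ * S = 1 := Matrix.nonsing_inv_mul _ hdet
  have hSt : S⁻¹.transpose = S⁻¹ := by rw [Matrix.transpose_nonsing_inv, hS]
  have conj : ∀ (X : Matrix n n ℝ) x,
      x ⬝ᵥ (S⁻¹ * X * S⁻¹).mulVec x = S⁻¹.mulVec x ⬝ᵥ X.mulVec (S⁻¹.mulVec x) := by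
    intro X x
    rw [← Matrix.mulVec_mulVec, ← Matrix.mulVec_mulVec, Matrix.dotProduct_mulVec,
      ← Matrix.mulVec_transpose, hSt]
  have hB : ∀ x, 0 ≤ x ⬝ᵥ (S⁻¹ * A * S⁻¹).mulVec x := fun x => by
    rw [conj]
    exact hA _
  have hBu := isUnit_one_add_of_accretive _ hB
  have hBdet := (Matrix.isUnit_iff_isUnit_det _).1 hBu
  have hAS : S⁻¹ * A = A * S⁻¹ := by
    calc S⁻¹ * A = S⁻¹ * A * (S * S⁻¹) := by rw [c1, mul_one]
      _ = S⁻¹ * (A * S) * S⁻¹ := by simp only [mul_assoc]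
      _ = S⁻¹ * S * A * S⁻¹ := by rw [← hSA]; simp only [mul_assoc]
      _ = A * S⁻¹ := by rw [c2, one_mul]
  have hP : S⁻¹ * A + S = S * (1 + S⁻¹ * A * S⁻¹) := by
    rw [mul_add, mul_one, add_comm, mul_assoc S⁻¹, ← mul_assoc S, c1, one_mul, hAS]
  have hK : ‖S⁻¹ * E * S⁻¹‖ ≤ 1 / 2 := by
    refine l2_opNorm_le_half_of_quadratic_le _ ?_ fun x => ?_
    · rw [Matrix.transpose_mul, Matrix.transpose_mul, hSt, hE, mul_assoc]
    · have h1 := hES (S⁻¹.mulVec x)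
      rwa [← conj, ← conj, ← mul_assoc, c2, one_mul, c1, Matrix.one_mulVec] at h1
  have hD : ‖(1 + S⁻¹ * A * S⁻¹)⁻¹ * (S⁻¹ * E * S⁻¹)‖ ≤ 1 / 2 := by
    refine (norm_mul_le _ _).trans ?_
    have := mul_le_mul (l2_opNorm_inv_one_add_le _ hB) hK (norm_nonneg _) zero_le_one
    linarith
  have hPu : IsUnit (S⁻¹ * A + S) := by
    rw [hP]
    exact hSu.mul hBu
  have hW : (S⁻¹ * A + S)⁻¹ * (S * S + E + A) * S⁻¹
      = 1 + (1 + S⁻¹ * A * S⁻¹)⁻¹ * (S⁻¹ * E * S⁻¹) := by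
    have e : S⁻¹ * (S * S + E + A) * S⁻¹ = (1 + S⁻¹ * A * S⁻¹) + S⁻¹ * E * S⁻¹ := by
      rw [mul_add, mul_add, add_mul, add_mul, ← mul_assoc, c2, one_mul, c1]
      abel
    rw [hP, Matrix.mul_inv_rev, mul_assoc, mul_assoc, ← mul_assoc S⁻¹, e, mul_add,
      Matrix.nonsing_inv_mul _ hBdet]
  rw [hW]
  exact ⟨hPu, cond2_one_add_le _ hD⟩

end Norm

/-! ### Kronecker products with the identity, and the square root of `κ G_τ`. -/

section Kronecker

variable {m n : Type*} [Fintype m] [Fintype n]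

theorem dotProduct_one_kronecker_mulVec [DecidableEq m] (A : Matrix n n ℝ) (x : m × n → ℝ) :
    x ⬝ᵥ ((1 : Matrix m m ℝ) ⊗ₖ A).mulVec x
      = ∑ i, (fun j => x (i, j)) ⬝ᵥ A.mulVec (fun j => x (i, j)) := by
  simp only [dotProduct, Matrix.mulVec, Fintype.sum_prod_type, Matrix.kroneckerMap_apply,
    Matrix.one_apply, ite_mul, one_mul, zero_mul]
  refine Finset.sum_congr rfl fun i _ => Finset.sum_congr rfl fun j _ => ?_
  congr 1
  rw [Finset.sum_comm]
  simp

theorem dotProduct_kronecker_one_mulVec [DecidableEq n] (H : Matrix m m ℝ) (x : m × n → ℝ) :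
    x ⬝ᵥ (H ⊗ₖ (1 : Matrix n n ℝ)).mulVec x
      = ∑ j, (fun i => x (i, j)) ⬝ᵥ H.mulVec (fun i => x (i, j)) := by
  simp only [dotProduct, Matrix.mulVec, Fintype.sum_prod_type, Matrix.kroneckerMap_apply,
    Matrix.one_apply, mul_ite, mul_one, mul_zero, ite_mul, zero_mul]
  rw [Finset.sum_comm]
  refine Finset.sum_congr rfl fun j _ => Finset.sum_congr rfl fun i _ => ?_
  congr 1
  simp

end Kronecker

section Sqrt

open scoped MatrixOrder

theorem sqrtGtau_mul_self {β κ : ℝ} (h1 : 1 < β) (h2 : β ≤ 2) (hκ : 0 < κ) (N : ℕ) :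
    sqrtGtau β κ N * sqrtGtau β κ N = κ • Gtau β N :=
  CFC.sqrt_mul_sqrt_self _ ((Gtau_posDef h1 h2 N).posSemidef.smul hκ.le).nonneg

theorem sqrtGtau_transpose (β κ : ℝ) (N : ℕ) :
    (sqrtGtau β κ N).transpose = sqrtGtau β κ N := by
  have := (Matrix.nonneg_iff_posSemidef.1 (CFC.sqrt_nonneg (κ • Gtau β N))).isHermitian
  rwa [Matrix.IsHermitian, Matrix.conjTranspose_eq_transpose_of_trivial] at this

theorem isUnit_sqrtGtau {β κ : ℝ} (h1 : 1 < β) (h2 : β ≤ 2) (hκ : 0 < κ) (N : ℕ) :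
    IsUnit (sqrtGtau β κ N) := by
  have hu := ((Gtau_posDef h1 h2 N).smul hκ).isUnit
  rw [← sqrtGtau_mul_self h1 h2 hκ, Matrix.isUnit_iff_isUnit_det, Matrix.det_mul] at hu
  rw [Matrix.isUnit_iff_isUnit_det]
  exact isUnit_of_mul_isUnit_left hu

end Sqrt

end BlochTorrey

end

/-! ### Assembly of the condition number bound. -/

theorem theorem3p4 (α β κ xL xR T : ℝ) (N M : ℕ)
    (hα : α ∈ Set.Ioo (0 : ℝ) 0.3624) (hβ : β ∈ Set.Ioc (1 : ℝ) 2) (hκ : 0 < κ)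
    (hx : xL < xR) (hT : 0 < T) (hN : 0 < N) (hM : 0 < M)
    (h τ : ℝ) (hh : h = (xR - xL) / N) (hτ : τ = T / M) :
    (BlochTorrey.Gtau β N).PosDef ∧
    IsUnit (BlochTorrey.Pl α β κ h τ N M) ∧
    IsUnit (BlochTorrey.Pr β κ N M) ∧
    IsUnit ((BlochTorrey.Pl α β κ h τ N M)⁻¹ * BlochTorrey.MTilde α β κ h τ N M *
      (BlochTorrey.Pr β κ N M)⁻¹) ∧
    BlochTorrey.cond2 ((BlochTorrey.Pl α β κ h τ N M)⁻¹ * BlochTorrey.MTilde α β κ h τ N M *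
      (BlochTorrey.Pr β κ N M)⁻¹) < 2 * Real.sqrt 3 := by
  obtain ⟨hα0, hα1⟩ := hα
  obtain ⟨hβ1, hβ2⟩ := hβ
  have hh0 : 0 ≤ h := hh ▸ div_nonneg (sub_nonneg.2 hx.le) (Nat.cast_nonneg N)
  have hτ0 : 0 ≤ τ := hτ ▸ div_nonneg hT.le (Nat.cast_nonneg M)
  set S := BlochTorrey.sqrtGtau β κ N with hS
  set A := BlochTorrey.At α β h τ M with hA
  have hSS : S * S = κ • BlochTorrey.Gtau β N := BlochTorrey.sqrtGtau_mul_self hβ1 hβ2 hκ N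
  have hSdet := (Matrix.isUnit_iff_isUnit_det _).1 (BlochTorrey.isUnit_sqrtGtau hβ1 hβ2 hκ N)
  have hinv : (S ⊗ₖ (1 : Matrix (Fin (M - 1)) (Fin (M - 1)) ℝ))⁻¹ = S⁻¹ ⊗ₖ 1 := by
    rw [Matrix.inv_kronecker, inv_one]
  have hPr : BlochTorrey.Pr β κ N M = S ⊗ₖ 1 := rfl
  have hPru : IsUnit (BlochTorrey.Pr β κ N M) := by
    rw [hPr]
    exact IsUnit.of_mul_eq_one (S⁻¹ ⊗ₖ 1) (by
      rw [← Matrix.mul_kronecker_mul, Matrix.mul_nonsing_inv _ hSdet, one_mul,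
        Matrix.one_kronecker_one])
  have hPl : BlochTorrey.Pl α β κ h τ N M
      = (S ⊗ₖ (1 : Matrix (Fin (M - 1)) (Fin (M - 1)) ℝ))⁻¹ * (1 ⊗ₖ A) + S ⊗ₖ 1 := by
    rw [hinv, ← Matrix.mul_kronecker_mul, mul_one, one_mul]
    rfl
  have hMT : BlochTorrey.MTilde α β κ h τ N M
      = (S ⊗ₖ (1 : Matrix (Fin (M - 1)) (Fin (M - 1)) ℝ)) * (S ⊗ₖ 1)
        + (κ • BlochTorrey.Hbeta β N) ⊗ₖ 1 + 1 ⊗ₖ A := by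
    rw [← Matrix.mul_kronecker_mul, one_mul, hSS, ← Matrix.add_kronecker, ← smul_add,
      BlochTorrey.Gtau, sub_add_cancel]
    rfl
  obtain ⟨u1, u2, u3⟩ := BlochTorrey.cond2_preconditioned_le
    (S ⊗ₖ (1 : Matrix (Fin (M - 1)) (Fin (M - 1)) ℝ)) (1 ⊗ₖ A)
    ((κ • BlochTorrey.Hbeta β N) ⊗ₖ 1)
    (by rw [← Matrix.kroneckerMap_transpose, Matrix.transpose_one, hS,
          BlochTorrey.sqrtGtau_transpose])
    (hPr ▸ hPru)
    (by simp only [← Matrix.mul_kronecker_mul, one_mul, mul_one])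
    (fun x => by
      rw [BlochTorrey.dotProduct_one_kronecker_mulVec]
      exact Finset.sum_nonneg fun i _ =>
        BlochTorrey.At_quadratic_nonneg hα0.le hα1.le hh0 hτ0 M _)
    (by
      rw [← Matrix.kroneckerMap_transpose, Matrix.transpose_one, Matrix.transpose_smul]
      congr 2
      ext i j
      exact BlochTorrey.Hbeta_symm β N j i)
    (fun x => by
      rw [← Matrix.mul_kronecker_mul, one_mul, hSS,
        BlochTorrey.dotProduct_kronecker_one_mulVec, BlochTorrey.dotProduct_kronecker_one_mulVec,
        Finset.sum_div]
      refine (Finset.abs_sum_le_sum_abs _ _).trans (Finset.sum_le_sum fun j _ => ?_)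
      have := mul_le_mul_of_nonneg_left
        (BlochTorrey.abs_Hbeta_quadratic_le hβ1 hβ2 N (fun i => x (i, j))) hκ.le
      rw [Matrix.smul_mulVec, Matrix.smul_mulVec, dotProduct_smul, dotProduct_smul, smul_eq_mul,
        smul_eq_mul, abs_mul, abs_of_pos hκ]
      linarith)
  rw [← hPl, ← hMT, ← hPr] at u2 u3
  rw [← hPl] at u1
  refine ⟨BlochTorrey.Gtau_posDef hβ1 hβ2 N, u1, hPru, u2, u3.trans_lt ?_⟩
  -- The bound obtained is `3`, and `3 < 2√3` is `3/2 < √3`.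
  have : (3 / 2 : ℝ) < Real.sqrt 3 := Real.lt_sqrt_of_sq_lt (by norm_num)
  linarith
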